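/- Let $S_n$ ($n\ge 0$) denote the group of permutations of $\{1,\dots,n\}$, let $s_i\in S_n$ be the transposition of $i$ and $i+1$, and let $w_0=n\cdots 21$. A permutation $w$ acts on $f\in\mathbb{Z}[\beta][x_1,\dots,x_n]$ by $w\cdot f=f(x_{w(1)},\dots,x_{w(n)})$. For $1\le i<n$ put $$\partial_i f=\frac{f-s_i\cdot f}{x_i-x_{i+1}},\qquad \pi_i f=\partial_i\bigl((1+\beta x_{i+1})f\bigr).$$ The $\beta$-Grothendieck polynomials $\mathfrak{G}^{(\beta)}_w(x)\in\mathbb{Z}[\beta][x_1,\dots,x_n]$, $w\in S_n$, are defined by $$\mathfrak{G}^{(\beta)}_{w_0}(x)=x_1^{n-1}x_2^{n-2}\cdots x_{n-1},\qquad \mathfrak{G}^{(\beta)}_w(x)=\pi_i\,\mathfrak{G}^{(\beta)}_{ws_i}(x)\quad\text{if } w(i)<w(i+1),$$ where $ws_i$ is obtained from $w$ by swapping $w(i)$ and $w(i+1)$ (the result does not depend on the choice of $i$; for definiteness take the smallest such $i$). The principal specialization of $\mathfrak{G}^{(\beta)}_w$ is $$\Upsilon_w(\beta)=\mathfrak{G}^{(\beta)}_w(x)\big|_{x_1=\cdots=x_n=1}\in\mathbb{Z}[\beta].$$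 **Proposition.** For every $n\ge 0$ and every permutation $w\in S_n$, $$\Upsilon_w(\beta)=\Upsilon_{w^{-1}}(\beta)\quad\text{in }\mathbb{Z}[\beta].$$ -/

import Mathlib

/-! The symmetric group `S_n` is `Equiv.Perm (Fin n)`, so positions, values and variables are
numbered from `0`. The coefficient ring is `ℤ[β]`, that is `Polynomial ℤ` with
`β = Polynomial.X`. -/

namespace Grothendieck

/-- `f - s · f` is divisible by `x_a - x_b`, where `s` is the transposition of `a` and `b`. -/
theorem X_sub_X_dvd {R : Type*} [CommRing R] {σ : Type*} [DecidableEq σ] (a b : σ)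
    (f : MvPolynomial σ R) :
    (MvPolynomial.X a - MvPolynomial.X b : MvPolynomial σ R) ∣
      f - MvPolynomial.rename (Equiv.swap a b) f := by
  induction f using MvPolynomial.induction_on with
  | C r => simp
  | add p q hp hq =>
    have h := dvd_add hp hq
    rw [map_add]
    convert h using 1
    ring
  | mul_X p k hp =>
    have hk : (MvPolynomial.X a - MvPolynomial.X b : MvPolynomial σ R) ∣
        MvPolynomial.X k - MvPolynomial.X (Equiv.swap a b k) := by
      by_cases h1 : k = a
      · subst h1
        simp
      · by_cases h2 : k = b
        · subst h2
          rw [Equiv.swap_apply_right, ← dvd_neg, neg_sub]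
        · simp [Equiv.swap_apply_of_ne_of_ne h1 h2]
    have h := dvd_add (dvd_mul_of_dvd_left hp (MvPolynomial.X k))
      (dvd_mul_of_dvd_right hk (MvPolynomial.rename (Equiv.swap a b) p))
    rw [map_mul, MvPolynomial.rename_X]
    convert h using 1
    ring

/-- The divided difference `∂ f = (f - s · f) / (x_a - x_b)`, where `s` is the transposition of
`a` and `b`: for `a ≠ b` it is the unique polynomial whose product with `x_a - x_b` is
`f - s · f` (see `X_sub_X_mul_dividedDiff`). -/
noncomputable def dividedDiff {R : Type*} [CommRing R] {σ : Type*} [DecidableEq σ] (a b : σ)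
    (f : MvPolynomial σ R) : MvPolynomial σ R :=
  Classical.choose (X_sub_X_dvd a b f)

theorem X_sub_X_mul_dividedDiff {R : Type*} [CommRing R] {σ : Type*} [DecidableEq σ] (a b : σ)
    (f : MvPolynomial σ R) :
    (MvPolynomial.X a - MvPolynomial.X b) * dividedDiff a b f =
      f - MvPolynomial.rename (Equiv.swap a b) f :=
  (Classical.choose_spec (X_sub_X_dvd a b f)).symm

/-- The isobaric operator `π f = ∂ ((1 + β x_b) f)`; the operator `π_i` is the case where `a`
and `b` are the consecutive indices `i` and `i + 1`. -/
noncomputable def isobaric {n : ℕ} (a b : Fin n) (f : MvPolynomial (Fin n) (Polynomial ℤ)) :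
    MvPolynomial (Fin n) (Polynomial ℤ) :=
  dividedDiff a b ((1 + MvPolynomial.C Polynomial.X * MvPolynomial.X b) * f)

/-- `i` and `i + 1` are positions of `w`, and `w(i) < w(i + 1)`. -/
def IsAscent {n : ℕ} (w : Equiv.Perm (Fin n)) (i : ℕ) : Prop :=
  ∃ h : i + 1 < n, w ⟨i, Nat.lt_of_succ_lt h⟩ < w ⟨i + 1, h⟩

/-- A permutation other than the order-reversing one `w₀` has an ascent. -/
theorem exists_isAscent {n : ℕ} {w : Equiv.Perm (Fin n)} (hw : w ≠ Fin.revPerm) :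
    ∃ i, IsAscent w i := by
  by_contra! hno
  apply hw
  have hanti : StrictAnti w := by
    cases n with
    | zero => exact fun a => a.elim0
    | succ m =>
      rw [Fin.strictAnti_iff_succ_lt]
      intro i
      refine lt_of_le_of_ne (not_lt.1 fun hlt => hno i ⟨by omega, hlt⟩) fun he => ?_
      have := congrArg Fin.val (w.injective he)
      simp at this
  have hmono : StrictMono (fun i => w (Fin.rev i)) := fun a b hab =>
    hanti (Fin.rev_lt_rev.2 hab)
  have hid : (fun i => w (Fin.rev i)) = id :=
    (hmono.range_inj strictMono_id).1 (by
      rw [Set.range_id, Set.range_eq_univ]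
      exact w.surjective.comp Fin.rev_surjective)
  ext i
  have := congrFun hid (Fin.rev i)
  simp only [Fin.rev_rev, id] at this
  simp [this]

/-- The quantity on which the recursion for Grothendieck polynomials terminates. -/
theorem sum_swap_lt {n : ℕ} {w : Equiv.Perm (Fin n)} {a b : Fin n} (hab : a < b)
    (hw : w a < w b) :
    ∑ k : Fin n, (k : ℕ) * ((w * Equiv.swap a b) k : ℕ) < ∑ k : Fin n, (k : ℕ) * (w k : ℕ) := by
  have hb : b ∈ Finset.univ.erase a := by simp [hab.ne']
  rw [← Finset.add_sum_erase _ _ (Finset.mem_univ a), ← Finset.add_sum_erase _ _ hb,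
    ← Finset.add_sum_erase Finset.univ (fun k : Fin n => (k : ℕ) * (w k : ℕ))
      (Finset.mem_univ a), ← Finset.add_sum_erase _ (fun k : Fin n => (k : ℕ) * (w k : ℕ)) hb]
  have hrest : ∑ k ∈ (Finset.univ.erase a).erase b, (k : ℕ) * ((w * Equiv.swap a b) k : ℕ) =
      ∑ k ∈ (Finset.univ.erase a).erase b, (k : ℕ) * (w k : ℕ) := by
    refine Finset.sum_congr rfl fun k hk => ?_
    simp only [Finset.mem_erase, Finset.mem_univ, and_true] at hk
    rw [Equiv.Perm.mul_apply, Equiv.swap_apply_of_ne_of_ne hk.2 hk.1]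
  rw [hrest, Equiv.Perm.mul_apply, Equiv.Perm.mul_apply, Equiv.swap_apply_left,
    Equiv.swap_apply_right]
  have h1 : (a : ℕ) < b := hab
  have h2 : (w a : ℕ) < w b := hw
  nlinarith

open scoped Classical in
/-- The `β`-Grothendieck polynomial of `w ∈ S_n`: it is `x_1^(n-1) x_2^(n-2) ⋯ x_(n-1)` for
`w = w₀`, and otherwise `π_i` applied to the polynomial of `w s_i`, where `i` is an ascent of `w`.
The result does not depend on the ascents used, since the `π_i` satisfy the Coxeter relations;
to have a definite recursion we take the smallest one. -/
noncomputable def grothendieck {n : ℕ} (w : Equiv.Perm (Fin n)) :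
    MvPolynomial (Fin n) (Polynomial ℤ) :=
  if hw : w = Fin.revPerm then ∏ k : Fin n, MvPolynomial.X k ^ (n - 1 - (k : ℕ))
  else
    have hi : IsAscent w (Nat.find (exists_isAscent hw)) := Nat.find_spec (exists_isAscent hw)
    let a : Fin n := ⟨Nat.find (exists_isAscent hw), Nat.lt_of_succ_lt hi.1⟩
    let b : Fin n := ⟨Nat.find (exists_isAscent hw) + 1, hi.1⟩
    isobaric a b (grothendieck (w * Equiv.swap a b))
  termination_by ∑ k : Fin n, (k : ℕ) * (w k : ℕ)
  decreasing_by exact sum_swap_lt (Fin.mk_lt_mk.2 (Nat.lt_succ_self _)) hi.2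

/-- The principal specialization `Υ_w(β) ∈ ℤ[β]`: all variables `x_i` of the `β`-Grothendieck
polynomial of `w` are set to `1`. -/
noncomputable def principalSpecialization {n : ℕ} (w : Equiv.Perm (Fin n)) : Polynomial ℤ :=
  MvPolynomial.eval (fun _ => 1) (grothendieck w)

end Grothendieck

/-! Fomin and Kirillov encode all Grothendieck polynomials of `S_n` in one element of the `0`-Hecke
algebra, the product of the factors `h_j(x_i) = 1 + x_i u_j` over a staircase-shaped reduced word
of `w₀`: the Yang–Baxter equation shows that its coefficients satisfy the recursion of the
Grothendieck polynomials, and the coefficient of `w₀` is `x_1^(n-1) ⋯ x_(n-1)`. When all variables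
are equal, commutations of distant factors alone turn the product into its own reversal, and
reversing the products in the Hecke algebra replaces `w` by `w⁻¹` in the coefficients. -/

namespace Grothendieck

section Words

variable {R : Type*}

/-- The list of factors of `h_i(x) h_{i+1}(x) ⋯ h_{i+k-1}(x)`. -/
def segment (i k : ℕ) (x : R) : List (ℕ × R) := (List.range' i k).map (·, x)

/-- The list of factors of the Fomin–Kirillov product: the segments that run from `j` to
`i + k - 1`, in the variable `X j`, where `j` decreases from `i + k - 1` to `i`. -/
def staircase (X : ℕ → R) : ℕ → ℕ → List (ℕ × R)
  | _, 0 => []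
  | i, k + 1 => staircase X (i + 1) k ++ segment i (k + 1) (X i)

theorem segment_succ (i k : ℕ) (x : R) : segment i (k + 1) x = (i, x) :: segment (i + 1) k x := rfl

theorem le_of_mem_segment {i k : ℕ} {x : R} {z : ℕ × R} (hz : z ∈ segment i k x) : i ≤ z.1 := by
  obtain ⟨j, hj, rfl⟩ := List.mem_map.1 hz
  exact (List.mem_range'_1.1 hj).1

theorem le_of_mem_staircase {X : ℕ → R} {i k : ℕ} {z : ℕ × R} (hz : z ∈ staircase X i k) :
    i ≤ z.1 := by
  induction k generalizing i with
  | zero => simp [staircase] at hz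
  | succ k ih =>
    rcases List.mem_append.1 hz with hz | hz
    · exact (Nat.le_succ i).trans (ih hz)
    · exact le_of_mem_segment hz

theorem staircase_congr {X Y : ℕ → R} (i k : ℕ) (h : ∀ j, i ≤ j → j < i + k → X j = Y j) :
    staircase X i k = staircase Y i k := by
  induction k generalizing i with
  | zero => rfl
  | succ k ih =>
    rw [staircase, staircase, ih (i + 1) fun j hj hjk => h j (by omega) (by omega),
      h i le_rfl (by omega)]

theorem map_staircase {S : Type*} (φ : R → S) (X : ℕ → R) (i k : ℕ) :
    (staircase X i k).map (Prod.map id φ) = staircase (φ ∘ X) i k := by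
  induction k generalizing i with
  | zero => rfl
  | succ k ih => simp [staircase, segment, ih, Function.comp_def]

end Words

section HeckeFactors

variable {R A : Type*} [CommRing R] [Ring A] [Algebra R A]

/-- The relations of the `0`-Hecke algebra of type `A` with parameter `b`. The generators are
indexed by all of `ℕ`; a finite family is extended by `0`. -/
structure HeckeRelations (b : R) (u : ℕ → A) : Prop where
  sq : ∀ i, u i * u i = b • u i
  comm : ∀ i j, i + 2 ≤ j → Commute (u i) (u j)
  braid : ∀ i, u i * u (i + 1) * u i = u (i + 1) * u i * u (i + 1)

/-- The factor `h_j(x) = 1 + x u_j` of Fomin and Kirillov. -/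
def hFactor (u : ℕ → A) (j : ℕ) (x : R) : A := 1 + x • u j

/-- The product `h_{j₁}(x₁) ⋯ h_{jₘ}(xₘ)` for the list of the pairs `(j₁, x₁), …, (jₘ, xₘ)`. -/
def factorProd (u : ℕ → A) (L : List (ℕ × R)) : A := (L.map fun z => hFactor u z.1 z.2).prod

section Products

variable (u : ℕ → A)

@[simp]
theorem factorProd_nil : factorProd u ([] : List (ℕ × R)) = 1 := rfl

@[simp]
theorem factorProd_cons (z : ℕ × R) (L : List (ℕ × R)) :
    factorProd u (z :: L) = hFactor u z.1 z.2 * factorProd u L := by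
  simp [factorProd]

@[simp]
theorem factorProd_append (L L' : List (ℕ × R)) :
    factorProd u (L ++ L') = factorProd u L * factorProd u L' := by
  simp [factorProd]

end Products

variable {u v : ℕ → A}

theorem commute_hFactor {i j : ℕ} (h : Commute (u i) (v j)) (x y : R) :
    Commute (hFactor u i x) (hFactor v j y) :=
  (Commute.one_left _).add_left
    (((Commute.one_right _).add_right (h.smul_right y)).smul_left x)

theorem commute_hFactor_factorProd {i : ℕ} {L : List (ℕ × R)}
    (h : ∀ z ∈ L, Commute (u i) (v z.1)) (x : R) :
    Commute (hFactor u i x) (factorProd v L) := by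
  refine Commute.list_prod_right _ _ fun a ha => ?_
  obtain ⟨z, hz, rfl⟩ := List.mem_map.1 ha
  exact commute_hFactor (h z hz) x z.2

theorem semiconjBy_factorProd {e : A} (h : ∀ j, SemiconjBy e (u j) (v j)) (L : List (ℕ × R)) :
    SemiconjBy e (factorProd u L) (factorProd v L) := by
  induction L with
  | nil => exact SemiconjBy.one_right e
  | cons z L ih =>
    have hz : SemiconjBy e (hFactor u z.1 z.2) (hFactor v z.1 z.2) :=
      (SemiconjBy.one_right e).add_right (by
        simp only [SemiconjBy, mul_smul_comm, smul_mul_assoc, (h z.1).eq])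
    simpa only [factorProd_cons] using hz.mul_right ih

theorem factorProd_apply_eq_reverse {M : Type*} [AddCommGroup M] [Module R M]
    {l r : ℕ → Module.End R M} (hlr : ∀ i j, Commute (l i) (r j)) {m : M}
    (hm : ∀ j, l j m = r j m) (L : List (ℕ × R)) :
    factorProd l L m = factorProd r L.reverse m := by
  induction L with
  | nil => rfl
  | cons z L ih =>
    have hz : hFactor l z.1 z.2 m = hFactor r z.1 z.2 m := by simp [hFactor, hm]
    have hcomm := (commute_hFactor_factorProd (fun z' _ => hlr z.1 z'.1) z.2 :
      Commute (hFactor l z.1 z.2) (factorProd r L.reverse)).eq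
    calc factorProd l (z :: L) m
        = hFactor l z.1 z.2 (factorProd r L.reverse m) := by simp [ih]
      _ = factorProd r L.reverse (hFactor l z.1 z.2 m) := LinearMap.congr_fun hcomm m
      _ = factorProd r (z :: L).reverse m := by simp [hz]

namespace HeckeRelations

variable {b : R}

theorem commute_factorProd (hu : HeckeRelations b u) {i : ℕ} {L : List (ℕ × R)}
    (hL : ∀ z ∈ L, i + 2 ≤ z.1) (x : R) : Commute (hFactor u i x) (factorProd u L) :=
  commute_hFactor_factorProd (fun z hz => hu.comm i z.1 (hL z hz)) x

/-- A division-free form of the Yang–Baxter equation: if `h_{i+1}(x)` and `h_{i+1}(y)` are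
invertible, it reads
`h_i(y) h_{i+1}(y) h_i(x) h_{i+1}(y)⁻¹ = h_i(x) h_{i+1}(x) h_i(y) h_{i+1}(x)⁻¹`. -/
theorem hFactor_exchange (hu : HeckeRelations b u) (i : ℕ) (x y : R) {c d : A}
    (h : hFactor u (i + 1) y * c = hFactor u (i + 1) x * d) :
    hFactor u i y * hFactor u (i + 1) y * hFactor u i x * c =
      hFactor u i x * hFactor u (i + 1) x * hFactor u i y * d := by
  have hpp (a : A) : u i * (u i * a) = b • (u i * a) := by
    rw [← mul_assoc, hu.sq, smul_mul_assoc]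
  have hqq (a : A) : u (i + 1) * (u (i + 1) * a) = b • (u (i + 1) * a) := by
    rw [← mul_assoc, hu.sq, smul_mul_assoc]
  have hqpq (a : A) : u (i + 1) * (u i * (u (i + 1) * a)) = u i * (u (i + 1) * (u i * a)) := by
    simp only [← mul_assoc, hu.braid]
  simp only [hFactor] at h ⊢
  generalize u i = p at *
  generalize u (i + 1) = q at *
  have key : (1 + y • p) * (1 + y • q) * (1 + x • p) * c -
      (1 + x • p) * (1 + x • q) * (1 + y • p) * d =
      (1 + (x + y + b * x * y) • p + (x * y) • (q * p) - (x * y) • (p * q)) *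
        ((1 + y • q) * c - (1 + x • q) * d) := by
    simp only [mul_add, add_mul, mul_sub, sub_mul, one_mul, mul_one, smul_mul_assoc,
      mul_smul_comm, smul_add, smul_sub, smul_smul, mul_assoc, hpp, hqq, hqpq]
    module
  rw [← sub_eq_zero, key, h, sub_self, mul_zero]

theorem commute_segment (hu : HeckeRelations b u) (i k : ℕ) (x y : R) :
    Commute (factorProd u (segment i k x)) (factorProd u (segment i k y)) := by
  induction k generalizing i with
  | zero => exact Commute.one_left _
  | succ k ih =>
    cases k with
    | zero => simpa [segment] using commute_hFactor (Commute.refl (u i)) x y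
    | succ k =>
      have regroup (x y : R) :
          factorProd u (segment i (k + 2) y) * factorProd u (segment i (k + 2) x) =
            hFactor u i y * hFactor u (i + 1) y * hFactor u i x *
              (factorProd u (segment (i + 2) k y) *
                factorProd u (segment (i + 1) (k + 1) x)) := by
        have hc := hu.commute_factorProd (i := i) (L := segment (i + 2) k y)
          (fun _ => le_of_mem_segment) x
        simp only [segment_succ, factorProd_cons, mul_assoc]
        rw [← mul_assoc (factorProd u (segment (i + 2) k y)), ← hc.eq, mul_assoc]
      rw [Commute, SemiconjBy, regroup, regroup]
      refine hu.hFactor_exchange i y x ?_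
      simpa only [segment_succ (i + 1), factorProd_cons, mul_assoc] using (ih (i + 1)).eq

theorem hFactor_mul_staircase (hu : HeckeRelations b u) (X : ℕ → R) {j : ℕ} (i k : ℕ)
    (hij : i ≤ j) (hjk : j < i + k) :
    hFactor u j (X (j + 1)) * factorProd u (staircase X i k) =
      hFactor u j (X j) * factorProd u (staircase (X ∘ Equiv.swap j (j + 1)) i k) := by
  induction k generalizing i with
  | zero => omega
  | succ k ih =>
    obtain hlt | rfl := hij.lt_or_eq
    · have hi : (X ∘ Equiv.swap j (j + 1)) i = X i := by
        rw [Function.comp_apply, Equiv.swap_apply_of_ne_of_ne (by omega) (by omega)]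
      simp only [staircase, factorProd_append, ← mul_assoc, hi, ih (i + 1) hlt (by omega)]
    cases k with
    | zero => simpa [staircase, segment] using (commute_hFactor (Commute.refl (u i)) _ _).eq
    | succ k =>
      have htail : staircase (X ∘ Equiv.swap i (i + 1)) (i + 2) k = staircase X (i + 2) k :=
        staircase_congr _ _ fun l hl _ => by
          rw [Function.comp_apply, Equiv.swap_apply_of_ne_of_ne (by omega) (by omega)]
      -- The new factor completes the segment from `i + 1` to one from `i`.
      have absorb (x y : R) : hFactor u i x * (factorProd u (staircase X (i + 2) k) *
          factorProd u (segment (i + 1) (k + 1) x) * factorProd u (segment i (k + 2) y)) =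
          factorProd u (staircase X (i + 2) k) *
            (factorProd u (segment i (k + 2) x) * factorProd u (segment i (k + 2) y)) := by
        have hc := hu.commute_factorProd (i := i) (L := staircase X (i + 2) k)
          (fun _ => le_of_mem_staircase) x
        rw [segment_succ i (k + 1) x, factorProd_cons, mul_assoc, ← mul_assoc, hc.eq]
        simp only [mul_assoc]
      simp only [staircase, htail, factorProd_append, Function.comp_apply, Equiv.swap_apply_left,
        Equiv.swap_apply_right]
      rw [absorb, absorb, (hu.commute_segment i (k + 2) (X (i + 1)) (X i)).eq]

theorem factorProd_staircase_append_segment (hu : HeckeRelations b u) (x : R) (i k : ℕ) :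
    factorProd u (staircase (fun _ => x) (i + 1) k ++ segment i (k + 1) x) =
      factorProd u ((segment i (k + 1) x).reverse ++ staircase (fun _ => x) (i + 1) k) := by
  induction k generalizing i with
  | zero => simp [staircase, segment]
  | succ k ih =>
    have hc := (hu.commute_factorProd (i := i) (L := staircase (fun _ => x) (i + 2) k)
      (fun _ => le_of_mem_staircase) x).eq
    simp only [factorProd_append] at ih ⊢
    rw [segment_succ i, staircase, List.reverse_cons]
    simp only [factorProd_append, factorProd_cons, factorProd_nil, mul_one]
    rw [ih (i + 1), mul_assoc, mul_assoc, ← mul_assoc _ (hFactor u i x), ← hc,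
      mul_assoc, ih (i + 1)]

theorem factorProd_staircase_const_reverse (hu : HeckeRelations b u) (x : R) (i k : ℕ) :
    factorProd u (staircase (fun _ => x) i k).reverse =
      factorProd u (staircase (fun _ => x) i k) := by
  induction k generalizing i with
  | zero => rfl
  | succ k ih =>
    rw [staircase, hu.factorProd_staircase_append_segment, List.reverse_append, factorProd_append,
      factorProd_append, ih]

end HeckeRelations

end HeckeFactors

section HeckeOperators

variable {R α : Type*} [CommRing R] [LinearOrder α]

/-- A function `F` on permutations stands for the combination `∑ F(w) T_w` of the basis of the
`0`-Hecke algebra with parameter `b`; for adjacent positions `p < q`, this operator is the right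
multiplication by the generator of the transposition of `p` and `q`. -/
def descentOp (b : R) (p q : α) : Module.End R (Equiv.Perm α → R) where
  toFun F w := if w q < w p then F (w * Equiv.swap p q) + b * F w else 0
  map_add' F G := by
    ext w
    simp only [Pi.add_apply]
    split_ifs <;> ring
  map_smul' c F := by
    ext w
    simp only [Pi.smul_apply, smul_eq_mul, RingHom.id_apply]
    split_ifs <;> ring

theorem descentOp_apply (b : R) (p q : α) (F : Equiv.Perm α → R) (w : Equiv.Perm α) :
    descentOp b p q F w = if w q < w p then F (w * Equiv.swap p q) + b * F w else 0 := rfl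

theorem descentOp_sq (b : R) (p q : α) :
    descentOp b p q * descentOp b p q = b • descentOp b p q := by
  refine LinearMap.ext fun F => funext fun w => ?_
  simp only [Module.End.mul_apply, LinearMap.smul_apply, Pi.smul_apply, descentOp_apply,
    Equiv.Perm.mul_apply, Equiv.swap_apply_left, Equiv.swap_apply_right, smul_eq_mul]
  split_ifs with hqp hpq
  · exact absurd hqp hpq.asymm
  · ring
  · ring

theorem commute_descentOp (b : R) {p q r s : α} (h : [p, q, r, s].Nodup) :
    Commute (descentOp b p q) (descentOp b r s) := by
  have hswap (w : Equiv.Perm α) :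
      w * Equiv.swap r s * Equiv.swap p q = w * Equiv.swap p q * Equiv.swap r s := by
    rw [mul_assoc, mul_assoc, (Equiv.Perm.disjoint_swap_swap h).commute.eq]
  simp only [List.nodup_cons, List.mem_cons, List.not_mem_nil, or_false, not_or] at h
  obtain ⟨⟨-, hpr, hps⟩, ⟨hqr, hqs⟩, -⟩ := h
  refine LinearMap.ext fun F => funext fun w => ?_
  simp only [Module.End.mul_apply, descentOp_apply, Equiv.Perm.mul_apply,
    Equiv.swap_apply_of_ne_of_ne hpr hps, Equiv.swap_apply_of_ne_of_ne hqr hqs,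
    Equiv.swap_apply_of_ne_of_ne (Ne.symm hpr) (Ne.symm hqr),
    Equiv.swap_apply_of_ne_of_ne (Ne.symm hps) (Ne.symm hqs), hswap]
  split_ifs <;> ring

theorem swap_braid {β : Type*} [DecidableEq β] {p q r : β} (hpq : p ≠ q) (hqr : q ≠ r)
    (hpr : p ≠ r) :
    Equiv.swap q r * Equiv.swap p q * Equiv.swap q r =
      Equiv.swap p q * Equiv.swap q r * Equiv.swap p q := by
  rw [Equiv.swap_mul_swap_mul_swap hpq hpr, Equiv.swap_comm p q, Equiv.swap_comm q r,
    Equiv.swap_mul_swap_mul_swap hqr.symm hpr.symm, Equiv.swap_comm]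

theorem descentOp_braid (b : R) {p q r : α} (hpq : p ≠ q) (hqr : q ≠ r) (hpr : p ≠ r) :
    descentOp b p q * descentOp b q r * descentOp b p q =
      descentOp b q r * descentOp b p q * descentOp b q r := by
  have hbraid (w : Equiv.Perm α) : w * Equiv.swap q r * Equiv.swap p q * Equiv.swap q r =
      w * Equiv.swap p q * Equiv.swap q r * Equiv.swap p q := by
    simpa only [mul_assoc] using congrArg (w * ·) (swap_braid hpq hqr hpr)
  refine LinearMap.ext fun F => funext fun w => ?_
  have hw₁ := w.injective.ne hpq
  have hw₂ := w.injective.ne hqr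
  simp only [Module.End.mul_apply, descentOp_apply, Equiv.Perm.mul_apply,
    Equiv.swap_apply_of_ne_of_ne hpr.symm hqr.symm, Equiv.swap_apply_of_ne_of_ne hpq hpr,
    Equiv.swap_apply_left, Equiv.swap_apply_right, hbraid, Equiv.mul_swap_mul_self]
  split_ifs <;> first | ring1 | (exfalso; order)

/-- The composition of functions on a group with the inversion. -/
def invOp (R G : Type*) [CommRing R] [Group G] : Module.End R (G → R) :=
  LinearMap.funLeft R R (fun g => g⁻¹)

theorem invOp_apply {G : Type*} [Group G] (F : G → R) (g : G) : invOp R G F g = F g⁻¹ := rfl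

theorem invOp_mul_invOp {G : Type*} [Group G] : invOp R G * invOp R G = 1 := by
  refine LinearMap.ext fun F => funext fun g => ?_
  simp [invOp_apply]

theorem invOp_single_one {G : Type*} [Group G] [DecidableEq G] :
    invOp R G (Pi.single 1 1) = Pi.single 1 1 := by
  ext g
  simp [invOp_apply, Pi.single_apply]

theorem swap_lt_swap_iff {p q a c : α} (hpq : p ⋖ q) (h : ¬(a = p ∧ c = q))
    (h' : ¬(a = q ∧ c = p)) : Equiv.swap p q a < Equiv.swap p q c ↔ a < c := by
  have hlt := hpq.lt
  have hgap (x : α) : x ≤ p ∨ q ≤ x := (lt_or_ge p x).symm.imp_right hpq.ge_of_gt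
  have ha := hgap a
  have hc := hgap c
  grind

theorem commute_invOp_conj_descentOp (b : R) {p q r s : α} (hpq : p ⋖ q) (hrs : r ⋖ s) :
    Commute (invOp R (Equiv.Perm α) * descentOp b p q * invOp R (Equiv.Perm α))
      (descentOp b r s) := by
  refine LinearMap.ext fun F => funext fun w => ?_
  simp only [Module.End.mul_apply, invOp_apply, descentOp_apply, Equiv.Perm.mul_apply, mul_inv_rev,
    inv_inv, Equiv.swap_inv]
  have hmul : w * Equiv.swap r s = Equiv.swap (w r) (w s) * w := Equiv.mul_swap_eq_swap_mul w r s
  by_cases h : w r = p ∧ w s = q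
  · obtain ⟨rfl, rfl⟩ := h
    simp [hpq.lt.not_gt, hrs.lt.not_gt]
  by_cases h' : w r = q ∧ w s = p
  · obtain ⟨rfl, rfl⟩ := h'
    rw [Equiv.swap_comm (w r)] at hmul
    simp [hpq.lt, hrs.lt, hpq.lt.not_gt, hrs.lt.not_gt, hmul]
  · have hlt : Equiv.swap p q (w s) < Equiv.swap p q (w r) ↔ w s < w r :=
      swap_lt_swap_iff hpq (by tauto) (by tauto)
    have hlt' : Equiv.swap r s (w⁻¹ q) < Equiv.swap r s (w⁻¹ p) ↔ w⁻¹ q < w⁻¹ p := by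
      apply swap_lt_swap_iff hrs <;> simp only [Equiv.Perm.inv_eq_iff_eq] <;> tauto
    simp only [hlt, hlt', mul_assoc]
    split_ifs <;> ring

theorem invOp_conj_descentOp_single_one [DecidableEq (Equiv.Perm α)] (b : R) (p q : α) :
    (invOp R (Equiv.Perm α) * descentOp b p q * invOp R (Equiv.Perm α)) (Pi.single 1 1) =
      descentOp b p q (Pi.single 1 1) := by
  ext w
  simp only [Module.End.mul_apply, invOp_single_one, invOp_apply, descentOp_apply, Pi.single_apply]
  have hs (v : Equiv.Perm α) : v * Equiv.swap p q = 1 ↔ v = Equiv.swap p q := by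
    rw [mul_eq_one_iff_eq_inv, Equiv.swap_inv]
  have hinv : w⁻¹ = Equiv.swap p q ↔ w = Equiv.swap p q := by
    rw [inv_eq_iff_eq_inv, Equiv.swap_inv]
  simp only [hs, hinv, inv_eq_one]
  by_cases h : w = Equiv.swap p q
  · simp [h]
  by_cases h1 : w = 1
  · simp [h1]
  · simp [h, h1]

end HeckeOperators

section SimpleOperators

variable {R : Type*} [CommRing R] {n : ℕ}

/-- The operator `descentOp` for the positions `j` and `j + 1`, and `0` if these are not positions
of a permutation in `S_n`. -/
def simpleOp (n : ℕ) (b : R) (j : ℕ) : Module.End R (Equiv.Perm (Fin n) → R) :=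
  if h : j + 1 < n then descentOp b ⟨j, Nat.lt_of_succ_lt h⟩ ⟨j + 1, h⟩ else 0

theorem simpleOp_of_lt (b : R) {j : ℕ} (h : j + 1 < n) :
    simpleOp n b j = descentOp b ⟨j, Nat.lt_of_succ_lt h⟩ ⟨j + 1, h⟩ :=
  dif_pos h

theorem heckeRelations_simpleOp (n : ℕ) (b : R) : HeckeRelations b (simpleOp n b) where
  sq i := by
    unfold simpleOp
    split_ifs
    · exact descentOp_sq _ _ _
    · simp
  comm i j hij := by
    unfold simpleOp
    split_ifs
    · apply commute_descentOp
      simp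
      omega
    all_goals simp
  braid i := by
    unfold simpleOp
    split_ifs
    · apply descentOp_braid <;> simp only [ne_eq, Fin.mk.injEq] <;> omega
    all_goals simp

theorem covBy_succ {j : ℕ} (h : j + 1 < n) : (⟨j, Nat.lt_of_succ_lt h⟩ : Fin n) ⋖ ⟨j + 1, h⟩ := by
  simp [Order.covBy_iff_add_one_eq]

/-- The operator `simpleOp` conjugated by `invOp`: the left multiplication by a generator. -/
def leftSimpleOp (n : ℕ) (b : R) (j : ℕ) : Module.End R (Equiv.Perm (Fin n) → R) :=
  invOp R _ * simpleOp n b j * invOp R _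

theorem semiconjBy_invOp (n : ℕ) (b : R) (j : ℕ) :
    SemiconjBy (invOp R _) (simpleOp n b j) (leftSimpleOp n b j) := by
  rw [SemiconjBy, leftSimpleOp, mul_assoc, invOp_mul_invOp, mul_one]

theorem commute_leftSimpleOp_simpleOp (n : ℕ) (b : R) (i j : ℕ) :
    Commute (leftSimpleOp n b i) (simpleOp n b j) := by
  unfold leftSimpleOp simpleOp
  split_ifs with hi hj
  · exact commute_invOp_conj_descentOp b (covBy_succ hi) (covBy_succ hj)
  all_goals simp

theorem leftSimpleOp_single_one (n : ℕ) (b : R) (j : ℕ) :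
    leftSimpleOp n b j (Pi.single 1 1) = simpleOp n b j (Pi.single 1 1) := by
  unfold leftSimpleOp simpleOp
  split_ifs
  · exact invOp_conj_descentOp_single_one b _ _
  · simp

end SimpleOperators

section GeneratingFunction

variable {R : Type*} [CommRing R] {n : ℕ}

/-- The Fomin–Kirillov product in the variables `X 0, …, X (n - 2)` as an element of the `0`-Hecke
algebra, written as a function on permutations: `generatingFunction n b X w` is the value of the
Grothendieck polynomial of `w` at `β = b` and `x = X`. -/
def generatingFunction (n : ℕ) (b : R) (X : ℕ → R) : Equiv.Perm (Fin n) → R :=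
  factorProd (simpleOp n b) (staircase X 0 (n - 1)) (Pi.single 1 1)

theorem generatingFunction_const_inv (b x : R) (w : Equiv.Perm (Fin n)) :
    generatingFunction n b (fun _ => x) w⁻¹ = generatingFunction n b (fun _ => x) w := by
  set L := staircase (fun _ => x) 0 (n - 1)
  have h : invOp R _ (factorProd (simpleOp n b) L (Pi.single 1 1)) =
      factorProd (simpleOp n b) L (Pi.single 1 1) :=
    calc invOp R _ (factorProd (simpleOp n b) L (Pi.single 1 1))
        = factorProd (leftSimpleOp n b) L (invOp R _ (Pi.single 1 1)) :=
          LinearMap.congr_fun (semiconjBy_factorProd (semiconjBy_invOp n b) L).eq _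
      _ = factorProd (simpleOp n b) L.reverse (Pi.single 1 1) := by
          rw [invOp_single_one, factorProd_apply_eq_reverse (commute_leftSimpleOp_simpleOp n b)
            (leftSimpleOp_single_one n b)]
      _ = factorProd (simpleOp n b) L (Pi.single 1 1) := by
          rw [(heckeRelations_simpleOp n b).factorProd_staircase_const_reverse]
  exact congrFun h w

variable {S : Type*} [CommRing S]

theorem comp_simpleOp (φ : R →+* S) (b : R) (j : ℕ) (F : Equiv.Perm (Fin n) → R) :
    φ ∘ simpleOp n b j F = simpleOp n (φ b) j (φ ∘ F) := by
  unfold simpleOp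
  ext w
  split_ifs
  · simp only [Function.comp_apply, descentOp_apply]
    split_ifs <;> simp
  · simp

theorem comp_factorProd (φ : R →+* S) (b : R) (L : List (ℕ × R)) (F : Equiv.Perm (Fin n) → R) :
    φ ∘ factorProd (simpleOp n b) L F =
      factorProd (simpleOp n (φ b)) (L.map (Prod.map id φ)) (φ ∘ F) := by
  induction L with
  | nil => rfl
  | cons z L ih =>
    have hsimple (G : Equiv.Perm (Fin n) → R) (w : Equiv.Perm (Fin n)) :
        φ (simpleOp n b z.1 G w) = simpleOp n (φ b) z.1 (φ ∘ G) w :=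
      congrFun (comp_simpleOp φ b z.1 G) w
    ext w
    simp [hFactor, ← ih, hsimple]

theorem comp_generatingFunction (φ : R →+* S) (b : R) (X : ℕ → R) :
    φ ∘ generatingFunction n b X = generatingFunction n (φ b) (φ ∘ X) := by
  have hsingle : φ ∘ (Pi.single 1 1 : Equiv.Perm (Fin n) → R) = Pi.single 1 1 := by
    ext w
    simp [Pi.single_apply, apply_ite φ]
  rw [generatingFunction, comp_factorProd, map_staircase, hsingle, generatingFunction]

theorem hFactor_simpleOp_apply (b x : R) {j : ℕ} (hj : j + 1 < n) (F : Equiv.Perm (Fin n) → R)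
    (w : Equiv.Perm (Fin n)) :
    hFactor (simpleOp n b) j x F w =
      F w + x * descentOp b ⟨j, Nat.lt_of_succ_lt hj⟩ ⟨j + 1, hj⟩ F w := by
  simp [hFactor, simpleOp_of_lt b hj]

theorem sub_mul_generatingFunction (b : R) (X : ℕ → R) {w : Equiv.Perm (Fin n)} {j : ℕ}
    (hj : j + 1 < n) (hw : w ⟨j, Nat.lt_of_succ_lt hj⟩ < w ⟨j + 1, hj⟩) :
    (X j - X (j + 1)) * generatingFunction n b X w =
      (1 + b * X (j + 1)) * generatingFunction n b X
        (w * Equiv.swap ⟨j, Nat.lt_of_succ_lt hj⟩ ⟨j + 1, hj⟩) -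
      (1 + b * X j) * generatingFunction n b (X ∘ Equiv.swap j (j + 1))
        (w * Equiv.swap ⟨j, Nat.lt_of_succ_lt hj⟩ ⟨j + 1, hj⟩) := by
  have hexch := (heckeRelations_simpleOp n b).hFactor_mul_staircase X 0 (n - 1) (Nat.zero_le j)
    (by omega)
  have hcoeff (v : Equiv.Perm (Fin n)) := congrFun (LinearMap.congr_fun hexch (Pi.single 1 1)) v
  have hdef (Y : ℕ → R) : factorProd (simpleOp n b) (staircase Y 0 (n - 1)) (Pi.single 1 1) =
      generatingFunction n b Y := rfl
  simp only [Module.End.mul_apply, hdef, hFactor_simpleOp_apply b _ hj, descentOp_apply] at hcoeff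
  have hsym : generatingFunction n b X w =
      generatingFunction n b (X ∘ Equiv.swap j (j + 1)) w := by
    simpa [hw.not_gt] using hcoeff w
  have hdesc := hcoeff (w * Equiv.swap ⟨j, Nat.lt_of_succ_lt hj⟩ ⟨j + 1, hj⟩)
  simp only [Equiv.Perm.mul_apply, Equiv.swap_apply_left, Equiv.swap_apply_right, hw, if_true,
    Equiv.mul_swap_mul_self] at hdesc
  linear_combination X j * hsym - hdesc

end GeneratingFunction

section TopCoefficient

/-- The number of inversions of a permutation, its length in the symmetric group. -/
def inversionCount {α : Type*} [Fintype α] [LinearOrder α] (w : Equiv.Perm α) : ℕ :=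
  (Finset.univ.filter fun z : α × α => z.1 < z.2 ∧ w z.2 < w z.1).card

section LeadingTerms

variable {R α : Type*} [CommRing R] [Fintype α] [LinearOrder α] {p q : α}

theorem inversionCount_mul_swap {w : Equiv.Perm α} (hpq : p ⋖ q) (hw : w p < w q) :
    inversionCount (w * Equiv.swap p q) = inversionCount w + 1 := by
  have hlt := hpq.lt
  set e := (Equiv.swap p q).prodCongr (Equiv.swap p q) with he
  have hset : (Finset.univ.filter fun z : α × α =>
      z.1 < z.2 ∧ (w * Equiv.swap p q) z.2 < (w * Equiv.swap p q) z.1) =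
      insert (p, q) ((Finset.univ.filter fun z : α × α =>
        z.1 < z.2 ∧ w z.2 < w z.1).map e.toEmbedding) := by
    ext ⟨a, c⟩
    rw [Finset.mem_filter, Finset.mem_insert, Finset.mem_map_equiv, Finset.mem_filter]
    simp only [Finset.mem_univ, true_and, he, Equiv.prodCongr_symm, Equiv.symm_swap,
      Equiv.prodCongr_apply, Prod.map_apply, Equiv.Perm.mul_apply, Prod.mk.injEq]
    by_cases h : a = p ∧ c = q
    · obtain ⟨rfl, rfl⟩ := h
      simp [hlt, hw]
    by_cases h' : a = q ∧ c = p
    · obtain ⟨rfl, rfl⟩ := h'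
      simp [hlt, hlt.not_gt, hw.not_gt, hlt.ne']
    · simp [swap_lt_swap_iff hpq h h', h]
  rw [inversionCount, hset, Finset.card_insert_of_notMem, Finset.card_map, inversionCount]
  simp [Finset.mem_map_equiv, he, hlt.not_gt]

theorem inversionCount_le_mul_swap_add_one (w : Equiv.Perm α) (hpq : p ⋖ q) :
    inversionCount w ≤ inversionCount (w * Equiv.swap p q) + 1 := by
  rcases (w.injective.ne hpq.ne).lt_or_gt with h | h
  · rw [inversionCount_mul_swap hpq h]
    omega
  · have hw := inversionCount_mul_swap (w := w * Equiv.swap p q) hpq (by simpa using h)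
    rw [Equiv.mul_swap_mul_self] at hw
    exact hw.le

/-- `F` takes the value `c` at `v` and vanishes at all permutations with more inversions than `v`.
Other permutations with as many inversions as `v` are not excluded from the support of `F`. -/
structure HasLeadingTerm (F : Equiv.Perm α → R) (v : Equiv.Perm α) (c : R) : Prop where
  eq_zero : ∀ w, inversionCount v < inversionCount w → F w = 0
  apply_eq : F v = c

theorem hasLeadingTerm_single_one : HasLeadingTerm (Pi.single 1 1 : Equiv.Perm α → R) 1 1 where
  eq_zero w hw := Pi.single_eq_of_ne (by rintro rfl; exact hw.ne rfl) _
  apply_eq := Pi.single_eq_same _ _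

theorem HasLeadingTerm.add_smul_descentOp {F : Equiv.Perm α → R} {v : Equiv.Perm α} {c : R}
    (h : HasLeadingTerm F v c) (b x : R) (hpq : p ⋖ q) (hv : v p < v q) :
    HasLeadingTerm (F + x • descentOp b p q F) (v * Equiv.swap p q) (x * c) := by
  have hcount := inversionCount_mul_swap hpq hv
  constructor
  · intro w hw
    have hle := inversionCount_le_mul_swap_add_one w hpq
    simp [descentOp_apply, h.eq_zero w (by omega), h.eq_zero (w * Equiv.swap p q) (by omega)]
  · simp [descentOp_apply, hv, h.eq_zero (v * Equiv.swap p q) (by omega), h.apply_eq]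

end LeadingTerms

variable {R : Type*} [CommRing R] {n : ℕ}

/-- The values of the permutations of `{0, …, n - 1}` that lead from the identity, at
`(i, j) = (0, n - 1)`, to the order-reversing permutation: the positions before `i` carry the
`i` largest values in decreasing order, the position `j` carries the next one, and the remaining
values are increasing. -/
def partialReversal (n i j k : ℕ) : ℕ :=
  if k < i then n - 1 - k else if k < j then k - i else if k = j then n - 1 - i else k - 1 - i

/-- `F` has a leading term with coefficient `c` at the permutation given by
`partialReversal n i j`. -/
def HasReversalTerm (F : Equiv.Perm (Fin n) → R) (i j : ℕ) (c : R) : Prop :=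
  ∃ v : Equiv.Perm (Fin n), (∀ k : Fin n, (v k : ℕ) = partialReversal n i j k) ∧
    HasLeadingTerm F v c

namespace HasReversalTerm

variable {F : Equiv.Perm (Fin n) → R} {i j : ℕ} {c : R}

theorem hFactor (h : HasReversalTerm F i (j + 1) c) (b x : R) (hij : i ≤ j) (hj : j + 1 < n) :
    HasReversalTerm (hFactor (simpleOp n b) j x F) i j (x * c) := by
  obtain ⟨v, hv, hF⟩ := h
  have hasc : v ⟨j, Nat.lt_of_succ_lt hj⟩ < v ⟨j + 1, hj⟩ := by
    rw [Fin.lt_def, hv, hv]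
    simp only [partialReversal]
    split_ifs <;> omega
  refine ⟨v * Equiv.swap ⟨j, Nat.lt_of_succ_lt hj⟩ ⟨j + 1, hj⟩, fun k => ?_, ?_⟩
  · rw [Equiv.Perm.mul_apply, hv]
    simp only [partialReversal, Equiv.swap_apply_def, Fin.ext_iff, apply_ite Fin.val]
    split_ifs <;> omega
  · simpa [Grothendieck.hFactor, simpleOp_of_lt b hj] using
      hF.add_smul_descentOp b x (covBy_succ hj) hasc

theorem segment (h : HasReversalTerm F i (n - 1) c) (b x : R) {k : ℕ} (hij : i ≤ j)
    (hjk : j + k + 1 = n) :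
    HasReversalTerm (factorProd (simpleOp n b) (segment j k x) F) i j (x ^ k * c) := by
  induction k generalizing j with
  | zero =>
    obtain rfl : j = n - 1 := by omega
    simpa [Grothendieck.segment] using h
  | succ k ih =>
    rw [segment_succ, factorProd_cons, pow_succ', mul_assoc]
    exact (ih (Nat.le_succ_of_le hij) (by omega)).hFactor b x hij (by omega)

theorem succ_left (h : HasReversalTerm F i i c) : HasReversalTerm F (i + 1) (n - 1) c := by
  obtain ⟨v, hv, hF⟩ := h
  refine ⟨v, fun k => (hv k).trans ?_, hF⟩
  simp only [partialReversal]
  split_ifs <;> omega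

theorem staircase (h : HasReversalTerm F i (n - 1) c) (b : R) (X : ℕ → R) {k : ℕ}
    (hik : i + k + 1 = n) :
    HasReversalTerm (factorProd (simpleOp n b) (staircase X i k) F) (i + k) (n - 1)
      ((∏ l ∈ Finset.range k, X (i + l) ^ (k - l)) * c) := by
  induction k generalizing i F c with
  | zero => simpa [Grothendieck.staircase] using h
  | succ k ih =>
    have hstep := ih (h.segment b (X i) le_rfl hik).succ_left (by omega)
    rw [Grothendieck.staircase, factorProd_append, Finset.prod_range_succ', ← add_assoc,
      add_right_comm]
    simpa [add_assoc, add_comm 1, mul_assoc] using hstep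

end HasReversalTerm

theorem generatingFunction_revPerm (b : R) (X : ℕ → R) :
    generatingFunction n b X Fin.revPerm = ∏ k : Fin n, X k ^ (n - 1 - (k : ℕ)) := by
  cases n with
  | zero =>
    simp [generatingFunction, staircase, Subsingleton.elim (Fin.revPerm : Equiv.Perm (Fin 0)) 1]
  | succ n =>
    have hid : HasReversalTerm (Pi.single 1 1 : Equiv.Perm (Fin (n + 1)) → R) 0 n 1 := by
      refine ⟨1, fun k => ?_, hasLeadingTerm_single_one⟩
      simp only [partialReversal, Equiv.Perm.one_apply]
      split_ifs <;> omega
    obtain ⟨v, hv, hF⟩ := hid.staircase b X (k := n) (by omega)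
    obtain rfl : v = Fin.revPerm := by
      ext k
      rw [hv, Fin.revPerm_apply, Fin.val_rev]
      simp only [partialReversal]
      split_ifs <;> omega
    rw [generatingFunction, Nat.add_sub_cancel, hF.apply_eq, Fin.prod_univ_castSucc,
      Finset.prod_range]
    simp

end TopCoefficient

section Recursion

open MvPolynomial

variable {n : ℕ}

/-- The variables `x_k` for `k < n`, followed by ones. -/
noncomputable def variableSeq (n : ℕ) : ℕ → MvPolynomial (Fin n) (Polynomial ℤ) :=
  Function.extend Fin.val X 1

theorem variableSeq_val (k : Fin n) : variableSeq n k = X k :=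
  Fin.val_injective.extend_apply _ _ k

theorem variableSeq_of_le {k : ℕ} (hk : n ≤ k) : variableSeq n k = 1 :=
  Function.extend_apply' _ _ _ (by rintro ⟨l, rfl⟩; exact hk.not_gt l.2)

theorem rename_comp_variableSeq (p q : Fin n) :
    rename (Equiv.swap p q) ∘ variableSeq n = variableSeq n ∘ Equiv.swap (p : ℕ) q := by
  ext1 k
  obtain hk | hk := lt_or_ge k n
  · lift k to Fin n using hk
    simp [variableSeq_val, Fin.val_injective.swap_apply]
  · have hswap : Equiv.swap (p : ℕ) q k = k :=
      Equiv.swap_apply_of_ne_of_ne (by omega) (by omega)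
    simp [hswap, variableSeq_of_le hk]

theorem rename_generatingFunction (p q : Fin n) (w : Equiv.Perm (Fin n)) :
    rename (Equiv.swap p q) (generatingFunction n (C Polynomial.X) (variableSeq n) w) =
      generatingFunction n (C Polynomial.X) (variableSeq n ∘ Equiv.swap (p : ℕ) q) w := by
  have h := comp_generatingFunction (n := n)
    (rename (R := Polynomial ℤ) (Equiv.swap p q)).toRingHom (C Polynomial.X) (variableSeq n)
  simpa [rename_comp_variableSeq] using congrFun h w

theorem isobaric_generatingFunction {w : Equiv.Perm (Fin n)} {j : ℕ} (hj : j + 1 < n)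
    (hw : w ⟨j, Nat.lt_of_succ_lt hj⟩ < w ⟨j + 1, hj⟩) :
    isobaric ⟨j, Nat.lt_of_succ_lt hj⟩ ⟨j + 1, hj⟩
        (generatingFunction n (C Polynomial.X) (variableSeq n)
          (w * Equiv.swap ⟨j, Nat.lt_of_succ_lt hj⟩ ⟨j + 1, hj⟩)) =
      generatingFunction n (C Polynomial.X) (variableSeq n) w := by
  have hX : (X ⟨j, Nat.lt_of_succ_lt hj⟩ - X ⟨j + 1, hj⟩ :
      MvPolynomial (Fin n) (Polynomial ℤ)) ≠ 0 :=
    sub_ne_zero.2 (X_injective.ne (by simp))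
  have hrec := sub_mul_generatingFunction (C Polynomial.X) (variableSeq n) hj hw
  apply mul_left_cancel₀ hX
  rw [isobaric, X_sub_X_mul_dividedDiff]
  simp only [map_mul, map_add, map_one, rename_C, rename_X, Equiv.swap_apply_right,
    rename_generatingFunction]
  rw [← variableSeq_val ⟨j, _⟩, ← variableSeq_val ⟨j + 1, _⟩]
  exact hrec.symm

theorem grothendieck_eq_generatingFunction (w : Equiv.Perm (Fin n)) :
    grothendieck w = generatingFunction n (C Polynomial.X) (variableSeq n) w := by
  classical
  induction w using grothendieck.induct with
  | case1 =>
    rw [grothendieck]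
    simp [generatingFunction_revPerm, variableSeq_val]
  | case2 w hw hi a b ih =>
    rw [grothendieck, dif_neg hw]
    dsimp only
    rw [ih]
    exact isobaric_generatingFunction hi.1 hi.2

theorem aeval_const_grothendieck {S : Type*} [CommRing S] [Algebra (Polynomial ℤ) S] (c : S)
    (w : Equiv.Perm (Fin n)) :
    aeval (fun _ => c) (grothendieck w) =
      generatingFunction n (algebraMap (Polynomial ℤ) S Polynomial.X) (fun _ => c) w := by
  have h := comp_generatingFunction (n := n)
    (aeval (R := Polynomial ℤ) (fun _ : Fin n => c)).toRingHom (C Polynomial.X) (variableSeq n)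
  have hX : staircase (aeval (R := Polynomial ℤ) (fun _ : Fin n => c) ∘ variableSeq n) 0 (n - 1) =
      staircase (fun _ => c) 0 (n - 1) := by
    refine staircase_congr _ _ fun k _ hk => ?_
    lift k to Fin n using by omega
    simp [variableSeq_val]
  rw [grothendieck_eq_generatingFunction]
  simpa [generatingFunction, hX] using congrFun h w

end Recursion

end Grothendieck

theorem proposition2p3_general {S : Type*} [CommRing S] [Algebra (Polynomial ℤ) S] (c : S) {n : ℕ}
    (w : Equiv.Perm (Fin n)) :
    MvPolynomial.aeval (fun _ => c) (Grothendieck.grothendieck w) =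
      MvPolynomial.aeval (fun _ => c) (Grothendieck.grothendieck w⁻¹) := by
  rw [Grothendieck.aeval_const_grothendieck, Grothendieck.aeval_const_grothendieck,
    Grothendieck.generatingFunction_const_inv]

theorem proposition2p3 (n : ℕ) (w : Equiv.Perm (Fin n)) :
    Grothendieck.principalSpecialization w = Grothendieck.principalSpecialization w⁻¹ := by
  simpa only [Grothendieck.principalSpecialization, MvPolynomial.aeval_eq_eval] using
    proposition2p3_general (1 : Polynomial ℤ) w
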